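/- Let $n \ge 0$ and let $D$ be a digraph on the vertex set $[n]=\{1,\dots,n\}$, i.e. a set of ordered pairs $(u,v)\in[n]\times[n]$ called edges (loops are allowed). Let $\overline{D}$ be the digraph on $[n]$ whose edges are exactly the pairs $(u,v)\in[n]\times[n]$ that are not edges of $D$. For a permutation $\pi=\pi_1\cdots\pi_n\in\mathfrak{S}_n$ put $\mathrm{Des}_D(\pi)=\{i\in\{1,\dots,n-1\} : (\pi_i,\pi_{i+1})\text{ is an edge of }D\}$, and let $$\mathcal{U}_D=\sum_{\pi\in\mathfrak{S}_n}F_{\mathrm{Des}_D(\pi)},\qquad F_I=\sum_{\substack{1\le i_1\le\cdots\le i_n\\ i_j<i_{j+1}\text{ for }j\in I}}z_{i_1}z_{i_2}\cdots z_{i_n}\in\mathbb{Q}[[z_1,z_2,\dots]]\quad (I\subseteq\{1,\dots,n-1\}).$$ For a partition $\lambda$ let $s_\lambda$ be the Schur function, the sum of the monomials of all semistandard Young tableaux of shape $\lambda$. Then $\mathcal{U}_D$ is in a unique way a finite $\mathbb{Q}$-linear combination of Schur functions; write $[s_\lambda]\,\mathcal{U}_D$ for the coefficient of $s_\lambda$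 in it. For every $1\le i\le n$ and the hook partition $\lambda=(i,1^{n-i})$, $[s_\lambda]\,\mathcal{U}_D$ is the number of permutations $\sigma\in\mathfrak{S}_n$ with $\mathrm{Des}_D(\sigma)=\{i,i+1,\dots,n-1\}$ (the empty set if $i=n$). In particular, $[s_{(1^n)}]\,\mathcal{U}_D$ is the number of Hamiltonian paths in $D$, and $[s_{(n)}]\,\mathcal{U}_D$ is the number of Hamiltonian paths in $\overline{D}$, where a Hamiltonian path is a sequence of distinct vertices that contains every vertex and in which every two consecutive vertices $u,v$ form an edge $(u,v)$ (for $n=0$ the empty sequence is the only one, and $(1^0)=(0)$ is the empty partition). -/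

import Mathlib

/-! Symmetric and quasisymmetric functions are elements of the ring `MvPowerSeries ℕ ℚ` of formal
power series over `ℚ` in countably many variables; the variables are indexed by `0, 1, 2, …`
instead of `1, 2, 3, …`.  The vertex set `[n]` is modelled by `Fin n`, while positions in a
permutation word, i.e. the elements of descent sets, are numbered `1, …, n - 1`. -/

namespace RedeiBerge

noncomputable section

/-- The formal sum `∑ x, z ^ (wt x)`: the coefficient of the monomial `z ^ m` is the number of
`x : ι` with `wt x = m`.  It is used only for `wt` with finite fibres (see `finite_words` and
`finite_tableaux`). -/
def formalSum {ι : Type} (wt : ι → (ℕ →₀ ℕ)) : MvPowerSeries ℕ ℚ :=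
  fun m => (Nat.card {x : ι // wt x = m} : ℚ)

/-- The set of `D`-descents of the permutation word `π_1 ⋯ π_n`: all `i ∈ {1, …, n - 1}` such that
`(π_i, π_{i+1})` is an edge of `D`.  The position `i` is the element `i - 1` of `Fin n`. -/
def descents {n : ℕ} (D : Digraph (Fin n)) (π : Equiv.Perm (Fin n)) : Set ℕ :=
  {i | ∃ a b : Fin n, (a : ℕ) + 1 = i ∧ (b : ℕ) = i ∧ D.Adj (π a) (π b)}

/-- The index sequences `i_1 ≤ ⋯ ≤ i_n` with `i_j < i_{j+1}` for all `j ∈ I`. -/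
abbrev FundamentalWord (n : ℕ) (I : Set ℕ) : Type :=
  {w : Fin n → ℕ // Monotone w ∧
    ∀ a b : Fin n, (a : ℕ) + 1 = (b : ℕ) → (b : ℕ) ∈ I → w a < w b}

/-- The exponent vector of the monomial `z_{i_1} ⋯ z_{i_n}`. -/
def FundamentalWord.weight {n : ℕ} {I : Set ℕ} (w : FundamentalWord n I) : ℕ →₀ ℕ :=
  ∑ j : Fin n, Finsupp.single (w.1 j) 1

/-- The fundamental quasisymmetric function `F_I` of degree `n`, for `I ⊆ {1, …, n - 1}`. -/
def fundamental (n : ℕ) (I : Set ℕ) : MvPowerSeries ℕ ℚ :=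
  formalSum (FundamentalWord.weight (n := n) (I := I))

/-- The Rédei-Berge symmetric function `U_D = ∑_π F_{Des_D(π)}`. -/
def redeiBerge {n : ℕ} (D : Digraph (Fin n)) : MvPowerSeries ℕ ℚ :=
  ∑ π : Equiv.Perm (Fin n), fundamental n (descents D π)

/-- The exponent vector of the monomial of a semistandard Young tableau. -/
def tableauWeight {μ : YoungDiagram} (T : SemistandardYoungTableau μ) : ℕ →₀ ℕ :=
  ∑ c ∈ μ.cells, Finsupp.single (T c.1 c.2) 1

/-- The Schur function `s_μ`, the sum of the monomials of all semistandard Young tableaux of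
shape `μ`. -/
def schur (μ : YoungDiagram) : MvPowerSeries ℕ ℚ :=
  formalSum (tableauWeight (μ := μ))

/-- `c` is a family of coefficients of an expansion of `f` as a finite `ℚ`-linear combination of
Schur functions: `f = ∑ μ, c μ • s_μ`. -/
def IsSchurExpansion (f : MvPowerSeries ℕ ℚ) (c : YoungDiagram →₀ ℚ) : Prop :=
  f = Finsupp.linearCombination ℚ schur c

/-- The hook partition `(i, 1^k)`. -/
def hook (i k : ℕ) (hi : 1 ≤ i) : YoungDiagram :=
  YoungDiagram.ofRowLens (i :: List.replicate k 1) (by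
    rw [List.sortedGE_iff_pairwise, List.pairwise_cons]
    refine ⟨fun b hb => ?_, List.pairwise_replicate.2 (Or.inr le_rfl)⟩
    rw [List.eq_of_mem_replicate hb]
    exact hi)

/-- The one-row partition `(n)`. -/
def oneRow (n : ℕ) : YoungDiagram :=
  YoungDiagram.ofRowLens [n] (by simp [List.sortedGE_iff_pairwise])

/-- The one-column partition `(1^n)`. -/
def oneColumn (n : ℕ) : YoungDiagram :=
  YoungDiagram.ofRowLens (List.replicate n 1) (by
    rw [List.sortedGE_iff_pairwise]
    exact List.pairwise_replicate.2 (Or.inr le_rfl))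

/-- A Hamiltonian path in `D`: a sequence of distinct vertices containing every vertex, in which
each vertex is joined to the next one by an edge.  (For `n = 0` the empty sequence counts.) -/
def IsHamiltonianPath {n : ℕ} (D : Digraph (Fin n)) (p : List (Fin n)) : Prop :=
  p.IsChain D.Adj ∧ p.Nodup ∧ ∀ v : Fin n, v ∈ p

/-- The number of Hamiltonian paths in `D`. -/
def ham {n : ℕ} (D : Digraph (Fin n)) : ℕ :=
  Nat.card {p : List (Fin n) // IsHamiltonianPath D p}

/-! The cardinalities used above are cardinalities of finite sets. -/

theorem finite_words (n : ℕ) (I : Set ℕ) (m : ℕ →₀ ℕ) :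
    Finite {w : FundamentalWord n I // w.weight = m} := by
  have key : ∀ (w : FundamentalWord n I) (j : Fin n), w.1 j ∈ w.weight.support := by
    intro w j
    rw [Finsupp.mem_support_iff]
    intro h
    have h' : (∑ k : Fin n, Finsupp.single (w.1 k) 1 : ℕ →₀ ℕ) (w.1 j) = 0 := h
    rw [Finsupp.finsetSum_apply] at h'
    have := (Finset.sum_eq_zero_iff.1 h') j (Finset.mem_univ j)
    simp at this
  refine Finite.of_injective
    (fun w => (fun j => ⟨w.1.1 j, (congrArg Finsupp.support w.2).subset (key w.1 j)⟩ : Fin n → m.support)) ?_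
  intro w w' h
  apply Subtype.ext
  apply Subtype.ext
  funext j
  exact congrArg Subtype.val (congrFun h j)

theorem finite_tableaux (μ : YoungDiagram) (m : ℕ →₀ ℕ) :
    Finite {T : SemistandardYoungTableau μ // tableauWeight T = m} := by
  have key : ∀ (T : SemistandardYoungTableau μ) (c : μ.cells),
      T c.1.1 c.1.2 ∈ (tableauWeight T).support := by
    intro T c
    rw [Finsupp.mem_support_iff]
    intro h
    have h' : (∑ d ∈ μ.cells, Finsupp.single (T d.1 d.2) 1 : ℕ →₀ ℕ) (T c.1.1 c.1.2) = 0 := h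
    rw [Finsupp.finsetSum_apply] at h'
    have := (Finset.sum_eq_zero_iff.1 h') c.1 c.2
    simp at this
  refine Finite.of_injective
    (fun T => (fun c => ⟨T.1 c.1.1 c.1.2, (congrArg Finsupp.support T.2).subset (key T.1 c)⟩ : μ.cells → m.support)) ?_
  intro T T' h
  apply Subtype.ext
  ext i j
  by_cases hc : (i, j) ∈ μ
  · exact congrArg Subtype.val (congrFun h ⟨(i, j), hc⟩)
  · rw [T.1.zeros hc, T'.1.zeros hc]

end

end RedeiBerge

/-!
Writing a permutation word together with a compatible weakly increasing word as a colouring of the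
vertices, the coefficient of `z ^ m` in `U_D` is seen to count the ways to give each colour `k` to
`m k` vertices and to arrange every colour class in a path of the complement of `D`.  This does not
depend on the order of the colours, so `U_D` is symmetric (`isSymmetricSeries_redeiBerge`).

Schur functions are symmetric by the Bender–Knuth involution, which on the Gelfand–Tsetlin pattern
of a tableau, i.e. on the row lengths of the diagrams of the cells with entries less than `l`, is a
reflection of each row length of one level in the interval allowed by the two neighbouring levels
(`isSymmetricSeries_schur`).  The Kostka matrix is unitriangular with respect to the statistic
`∑ i, i * m i`: the entries of a semistandard tableau are at least their row indices, with equality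
throughout only for the highest weight tableau.  Hence Schur functions are linearly independent
(`linearIndependent_schur`), and a homogeneous symmetric series, which is determined by its
coefficients at partitions, has a Schur expansion (`exists_isSchurExpansion`).

For the hook coefficients, standardization gives `s_μ = ∑ F_{Des(T)}` over the standard tableaux `T`
of shape `μ` (`schur_eq_sum_fundamental`).  A standard tableau has the descent set
`{i, …, n - 1}` only if its entries `1, …, i` fill the first row and `i + 1, …, n` go down the first
column, so this set occurs exactly once for the hook `(i, 1 ^ (n - i))` and never for another shape
(`card_standardTableau_columnDescents`).  The coefficient of `F_{{i, …, n - 1}}` is well defined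
(`exists_fundamental_functional`), and comparing it in `U_D` and in its Schur expansion gives the
hook coefficient.  The extreme hooks `i = 1` and `i = n` give the Hamiltonian paths of `D` and of
its complement.
-/

namespace RedeiBerge

open Finset

section

/-! ### Tableaux as chains of Young diagrams -/

theorem coeff_formalSum {ι : Type} (wt : ι → (ℕ →₀ ℕ)) (m : ℕ →₀ ℕ) :
    MvPowerSeries.coeff m (formalSum wt) = (Nat.card {x : ι // wt x = m} : ℚ) := rfl

theorem card_eq_sum_rowLen (ν : YoungDiagram) {N : ℕ} (hN : ∀ c ∈ ν, c.1 < N) :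
    ν.card = ∑ i ∈ range N, ν.rowLen i := by
  rw [YoungDiagram.card, Finset.card_eq_sum_card_fiberwise (f := Prod.fst) (t := range N)]
  · refine Finset.sum_congr rfl fun i _ => ?_
    rw [YoungDiagram.rowLen_eq_card]
    rfl
  · intro c hc
    simpa using hN c (by simpa using hc)

theorem rowLen_ext {μ ν : YoungDiagram} (h : ∀ i, μ.rowLen i = ν.rowLen i) : μ = ν := by
  ext ⟨i, j⟩
  rw [YoungDiagram.mem_cells, YoungDiagram.mem_cells, YoungDiagram.mem_iff_lt_rowLen,
    YoungDiagram.mem_iff_lt_rowLen, h]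

variable {μ : YoungDiagram}

theorem tableauWeight_apply (T : SemistandardYoungTableau μ) (l : ℕ) :
    tableauWeight T l = #{c ∈ μ.cells | T c.1 c.2 = l} := by
  rw [tableauWeight, Finsupp.finsetSum_apply, Finset.card_filter]
  exact Finset.sum_congr rfl fun c _ => by rw [Finsupp.single_apply]

/-- The Young diagram of the cells of a tableau with entry less than `l`.  The row lengths of these
diagrams, for all `l`, form the Gelfand–Tsetlin pattern of the tableau. -/
def sublevel (T : SemistandardYoungTableau μ) (l : ℕ) : YoungDiagram where
  cells := {c ∈ μ.cells | T c.1 c.2 < l}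
  isLowerSet := by
    rintro ⟨i, j⟩ ⟨i', j'⟩ ⟨hi : i' ≤ i, hj : j' ≤ j⟩ h
    simp only [coe_filter, YoungDiagram.mem_cells, Set.mem_ofPred_eq] at h ⊢
    exact ⟨μ.up_left_mem hi hj h.1,
      ((T.col_weak hi (μ.up_left_mem le_rfl hj h.1)).trans (T.row_weak_of_le hj h.1)).trans_lt h.2⟩

theorem mem_sublevel {T : SemistandardYoungTableau μ} {l i j : ℕ} :
    (i, j) ∈ sublevel T l ↔ (i, j) ∈ μ ∧ T i j < l := by
  rw [← YoungDiagram.mem_cells]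
  simp [sublevel]

theorem lt_rowLen_sublevel {T : SemistandardYoungTableau μ} {l i j : ℕ} :
    j < (sublevel T l).rowLen i ↔ (i, j) ∈ μ ∧ T i j < l := by
  rw [← YoungDiagram.mem_iff_lt_rowLen, mem_sublevel]

theorem rowLen_sublevel_le_succ (T : SemistandardYoungTableau μ) (l i : ℕ) :
    (sublevel T l).rowLen i ≤ (sublevel T (l + 1)).rowLen i := by
  refine le_of_forall_lt fun j hj => ?_
  rw [lt_rowLen_sublevel] at hj ⊢
  exact ⟨hj.1, by omega⟩

theorem rowLen_succ_sublevel_succ_le (T : SemistandardYoungTableau μ) (l i : ℕ) :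
    (sublevel T (l + 1)).rowLen (i + 1) ≤ (sublevel T l).rowLen i := by
  refine le_of_forall_lt fun j hj => ?_
  rw [lt_rowLen_sublevel] at hj ⊢
  have := T.col_strict (Nat.lt_add_one i) hj.1
  exact ⟨μ.up_left_mem (Nat.le_succ i) le_rfl hj.1, by omega⟩

/-- A tableau is determined by its Gelfand–Tsetlin pattern. -/
theorem ext_of_rowLen_sublevel {T T' : SemistandardYoungTableau μ}
    (h : ∀ l i, (sublevel T l).rowLen i = (sublevel T' l).rowLen i) : T = T' := by
  ext i j
  by_cases hc : (i, j) ∈ μ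
  · refine eq_of_forall_gt_iff fun l => ?_
    have := lt_rowLen_sublevel (T := T) (l := l) (i := i) (j := j)
    rw [h, lt_rowLen_sublevel] at this
    simpa [hc] using this.symm
  · rw [T.zeros hc, T'.zeros hc]

theorem tableauWeight_add_card_sublevel (T : SemistandardYoungTableau μ) (l : ℕ) :
    tableauWeight T l + (sublevel T l).card = (sublevel T (l + 1)).card := by
  rw [tableauWeight_apply, YoungDiagram.card, YoungDiagram.card]
  rw [← Finset.card_union_of_disjoint]
  · congr 1
    ext c
    simp only [sublevel, mem_union, mem_filter]
    grind
  · rw [Finset.disjoint_left]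
    intro c
    simp only [sublevel, mem_filter]
    grind

/-! ### The Bender–Knuth involution -/

section

variable (T : SemistandardYoungTableau μ) (k i : ℕ)

/-- The least value of the row length `i` of level `k + 1` which is compatible with the levels `k`
and `k + 2`. -/
def toggleMin : ℕ :=
  max ((sublevel T k).rowLen i) ((sublevel T (k + 2)).rowLen (i + 1))

/-- The greatest value of the row length `i` of level `k + 1` which is compatible with the levels
`k` and `k + 2`. -/
def toggleMax : ℕ → ℕ
  | 0 => (sublevel T (k + 2)).rowLen 0
  | i + 1 => min ((sublevel T (k + 2)).rowLen (i + 1)) ((sublevel T k).rowLen i)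

theorem toggleMin_le : toggleMin T k i ≤ (sublevel T (k + 1)).rowLen i :=
  max_le (rowLen_sublevel_le_succ T k i) (rowLen_succ_sublevel_succ_le T (k + 1) i)

theorem le_toggleMax : (sublevel T (k + 1)).rowLen i ≤ toggleMax T k i := by
  cases i with
  | zero => exact rowLen_sublevel_le_succ T (k + 1) 0
  | succ i =>
    exact le_min (rowLen_sublevel_le_succ T (k + 1) (i + 1)) (rowLen_succ_sublevel_succ_le T k i)

theorem toggleMin_add_toggleMax_succ :
    toggleMin T k i + toggleMax T k (i + 1) =
      (sublevel T k).rowLen i + (sublevel T (k + 2)).rowLen (i + 1) := by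
  rw [toggleMin, toggleMax, min_comm, max_add_min]

/-- The reflection of the row length `i` of level `k + 1` in the interval of its values which are
compatible with the levels `k` and `k + 2`. -/
def toggle : ℕ :=
  toggleMin T k i + toggleMax T k i - (sublevel T (k + 1)).rowLen i

theorem toggle_add_rowLen :
    toggle T k i + (sublevel T (k + 1)).rowLen i = toggleMin T k i + toggleMax T k i :=
  Nat.sub_add_cancel ((le_toggleMax T k i).trans (Nat.le_add_left _ _))

theorem toggleMin_le_toggle : toggleMin T k i ≤ toggle T k i := by
  have := toggle_add_rowLen T k i
  have := le_toggleMax T k i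
  omega

theorem toggle_le_toggleMax : toggle T k i ≤ toggleMax T k i := by
  have := toggle_add_rowLen T k i
  have := toggleMin_le T k i
  omega

theorem rowLen_sublevel_le_toggle : (sublevel T k).rowLen i ≤ toggle T k i :=
  (le_max_left _ _).trans (toggleMin_le_toggle T k i)

theorem rowLen_succ_sublevel_le_toggle : (sublevel T (k + 2)).rowLen (i + 1) ≤ toggle T k i :=
  (le_max_right _ _).trans (toggleMin_le_toggle T k i)

theorem toggle_le_rowLen_sublevel : toggle T k i ≤ (sublevel T (k + 2)).rowLen i := by
  refine (toggle_le_toggleMax T k i).trans ?_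
  cases i with
  | zero => exact le_rfl
  | succ i => exact min_le_left _ _

theorem toggle_succ_le_rowLen_sublevel : toggle T k (i + 1) ≤ (sublevel T k).rowLen i :=
  (toggle_le_toggleMax T k (i + 1)).trans (min_le_right _ _)

theorem sum_toggle (N : ℕ) :
    ∑ i ∈ range N, toggle T k i + ∑ i ∈ range N, (sublevel T (k + 1)).rowLen i +
        toggleMax T k N =
      ∑ i ∈ range N, (sublevel T k).rowLen i +
        ∑ i ∈ range (N + 1), (sublevel T (k + 2)).rowLen i := by
  induction N with
  | zero => simp [toggleMax]
  | succ N ih =>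
    rw [sum_range_succ (fun i => (sublevel T (k + 2)).rowLen i) (N + 1), sum_range_succ,
      sum_range_succ, sum_range_succ (fun i => (sublevel T k).rowLen i)]
    have h := toggle_add_rowLen T k N
    have h' := toggleMin_add_toggleMax_succ T k N
    omega

/-- The Bender–Knuth involution: the row lengths of level `k + 1` are replaced by their
reflections, which changes only entries `k` into `k + 1` and conversely. -/
def benderKnuth : SemistandardYoungTableau μ where
  entry i j := if (i, j) ∈ μ ∧ (T i j = k ∨ T i j = k + 1) then
    (if j < toggle T k i then k else k + 1) else T i j
  row_weak' := by
    intro i j₁ j₂ hj hc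
    have hc' := μ.up_left_mem le_rfl hj.le hc
    have := T.row_weak hj hc
    grind
  col_strict' := by
    intro i₁ i₂ j hi hc
    induction i₂, hi using Nat.le_induction with
    | base =>
      have hc' := μ.up_left_mem (Nat.le_succ i₁) le_rfl hc
      have h := T.col_strict (Nat.lt_add_one i₁) hc
      have h1 := rowLen_succ_sublevel_le_toggle T k i₁
      have h2 := toggle_succ_le_rowLen_sublevel T k i₁
      have h3 := lt_rowLen_sublevel (T := T) (l := k) (i := i₁) (j := j)
      have h4 := lt_rowLen_sublevel (T := T) (l := k + 2) (i := i₁ + 1) (j := j)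
      grind
    | succ i₂ hi ih =>
      have hc' := μ.up_left_mem (Nat.le_succ i₂) le_rfl hc
      refine (ih hc').trans ?_
      have h := T.col_strict (Nat.lt_add_one i₂) hc
      have h1 := rowLen_succ_sublevel_le_toggle T k i₂
      have h2 := toggle_succ_le_rowLen_sublevel T k i₂
      have h3 := lt_rowLen_sublevel (T := T) (l := k) (i := i₂) (j := j)
      have h4 := lt_rowLen_sublevel (T := T) (l := k + 2) (i := i₂ + 1) (j := j)
      grind
  zeros' := by
    intro i j hc
    rw [if_neg (fun h => hc h.1), T.zeros hc]

theorem benderKnuth_apply (i j : ℕ) :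
    benderKnuth T k i j = if (i, j) ∈ μ ∧ (T i j = k ∨ T i j = k + 1) then
      (if j < toggle T k i then k else k + 1) else T i j := rfl

theorem sublevel_benderKnuth {l : ℕ} (hl : l ≠ k + 1) :
    sublevel (benderKnuth T k) l = sublevel T l := by
  refine YoungDiagram.ext ?_
  ext ⟨i, j⟩
  rw [YoungDiagram.mem_cells, YoungDiagram.mem_cells, mem_sublevel, mem_sublevel,
    benderKnuth_apply]
  grind

theorem rowLen_sublevel_benderKnuth :
    (sublevel (benderKnuth T k) (k + 1)).rowLen i = toggle T k i := by
  refine eq_of_forall_lt_iff fun j => ?_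
  rw [lt_rowLen_sublevel, benderKnuth_apply]
  have h1 := rowLen_sublevel_le_toggle T k i
  have h2 := toggle_le_rowLen_sublevel T k i
  have h3 := lt_rowLen_sublevel (T := T) (l := k) (i := i) (j := j)
  have h4 := lt_rowLen_sublevel (T := T) (l := k + 2) (i := i) (j := j)
  grind

theorem benderKnuth_benderKnuth : benderKnuth (benderKnuth T k) k = T := by
  refine ext_of_rowLen_sublevel fun l i => ?_
  rcases eq_or_ne l (k + 1) with rfl | hl
  · have h1 := toggle_add_rowLen T k i
    have h2 := toggle_add_rowLen (benderKnuth T k) k i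
    have h3 : toggleMin (benderKnuth T k) k i = toggleMin T k i := by
      simp only [toggleMin, sublevel_benderKnuth T k (l := k) (by omega),
        sublevel_benderKnuth T k (l := k + 2) (by omega)]
    have h4 : toggleMax (benderKnuth T k) k i = toggleMax T k i := by
      cases i <;> simp only [toggleMax, sublevel_benderKnuth T k (l := k) (by omega),
        sublevel_benderKnuth T k (l := k + 2) (by omega)]
    rw [rowLen_sublevel_benderKnuth] at h2 ⊢
    omega
  · rw [sublevel_benderKnuth _ k hl, sublevel_benderKnuth _ k hl]

theorem card_sublevel_benderKnuth :
    (sublevel (benderKnuth T k) (k + 1)).card + (sublevel T (k + 1)).card =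
      (sublevel T k).card + (sublevel T (k + 2)).card := by
  obtain ⟨N, hN⟩ : ∃ N, ∀ c ∈ μ, c.1 < N := by
    refine ⟨μ.colLen 0, fun c hc => YoungDiagram.mem_iff_lt_colLen.1 ?_⟩
    exact μ.up_left_mem le_rfl (Nat.zero_le _) hc
  have hs : ∀ (T' : SemistandardYoungTableau μ) (l : ℕ), ∀ c ∈ sublevel T' l, c.1 < N + 1 :=
    fun T' l c hc => (hN c (mem_sublevel.1 hc).1).trans (Nat.lt_succ_self N)
  have h0 : ∀ j, N ≤ j → (sublevel T (k + 2)).rowLen j = 0 := by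
    intro j hj
    by_contra h
    have := hN _ (lt_rowLen_sublevel.1 (Nat.pos_of_ne_zero h)).1
    simp only at this
    omega
  have key := sum_toggle T k (N + 1)
  rw [card_eq_sum_rowLen _ (hs _ _), card_eq_sum_rowLen _ (hs _ _), card_eq_sum_rowLen _ (hs _ _),
    card_eq_sum_rowLen _ (hs _ _)]
  simp only [rowLen_sublevel_benderKnuth]
  rw [sum_range_succ (fun i => (sublevel T (k + 2)).rowLen i) (N + 1), h0 (N + 1) (by omega)] at key
  have h1 : toggleMax T k (N + 1) = 0 := by simp [toggleMax, h0 (N + 1) (by omega)]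
  omega

theorem tableauWeight_benderKnuth :
    tableauWeight (benderKnuth T k) =
      (tableauWeight T).equivMapDomain (Equiv.swap k (k + 1)) := by
  ext l
  rw [Finsupp.equivMapDomain_apply, Equiv.symm_swap]
  have hl := tableauWeight_add_card_sublevel T l
  have hl' := tableauWeight_add_card_sublevel (benderKnuth T k) l
  have hk := tableauWeight_add_card_sublevel T k
  have hk' := tableauWeight_add_card_sublevel T (k + 1)
  have hc := card_sublevel_benderKnuth T k
  rcases eq_or_ne l k with rfl | h1
  · rw [Equiv.swap_apply_left]
    rw [sublevel_benderKnuth T l (by omega)] at hl'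
    simp only [add_assoc, Nat.reduceAdd] at *
    omega
  rcases eq_or_ne l (k + 1) with rfl | h2
  · rw [Equiv.swap_apply_right]
    rw [sublevel_benderKnuth T k (l := k + 1 + 1) (by omega)] at hl'
    simp only [add_assoc, Nat.reduceAdd] at *
    omega
  · rw [Equiv.swap_apply_of_ne_of_ne h1 h2]
    rw [sublevel_benderKnuth T k h2, sublevel_benderKnuth T k (by omega)] at hl'
    omega

end

/-- A power series is symmetric if its coefficients do not change when two adjacent variables are
interchanged. -/
def IsSymmetricSeries (f : MvPowerSeries ℕ ℚ) : Prop :=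
  ∀ (k : ℕ) (m : ℕ →₀ ℕ),
    MvPowerSeries.coeff (m.equivMapDomain (Equiv.swap k (k + 1))) f = MvPowerSeries.coeff m f

theorem equivMapDomain_swap_swap (k l : ℕ) (m : ℕ →₀ ℕ) :
    (m.equivMapDomain (Equiv.swap k l)).equivMapDomain (Equiv.swap k l) = m := by
  rw [← Finsupp.equivMapDomain_trans]
  simp

theorem isSymmetricSeries_schur (μ : YoungDiagram) : IsSymmetricSeries (schur μ) := by
  intro k m
  rw [schur, coeff_formalSum, coeff_formalSum]
  congr 1
  refine Nat.card_congr ⟨fun T => ⟨benderKnuth T.1 k, ?_⟩, fun T => ⟨benderKnuth T.1 k, ?_⟩,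
    fun T => Subtype.ext (benderKnuth_benderKnuth T.1 k),
    fun T => Subtype.ext (benderKnuth_benderKnuth T.1 k)⟩
  · rw [tableauWeight_benderKnuth, T.2, equivMapDomain_swap_swap]
  · rw [tableauWeight_benderKnuth, T.2]

end

section

/-! ### Triangularity of the Schur functions -/

/-- The exponent vector `(λ₁, λ₂, …)` of a partition `λ`. -/
noncomputable def shapeWeight (μ : YoungDiagram) : ℕ →₀ ℕ :=
  tableauWeight (SemistandardYoungTableau.highestWeight μ)

theorem shapeWeight_apply (μ : YoungDiagram) (i : ℕ) : shapeWeight μ i = μ.rowLen i := by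
  rw [shapeWeight, tableauWeight_apply, YoungDiagram.rowLen_eq_card, YoungDiagram.row]
  congr 1
  refine Finset.filter_congr fun c hc => ?_
  rw [SemistandardYoungTableau.highestWeight_apply, if_pos (by simpa using hc)]

theorem shapeWeight_injective : Function.Injective shapeWeight := fun μ ν h =>
  rowLen_ext fun i => by rw [← shapeWeight_apply, h, shapeWeight_apply]

theorem exists_shapeWeight_eq {m : ℕ →₀ ℕ} (hm : ∀ k, m (k + 1) ≤ m k) :
    ∃ μ, shapeWeight μ = m := by
  have hanti : Antitone m := antitone_nat_of_succ_le hm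
  have hmem : ∀ i j, (i, j) ∈ {c ∈ m.support ×ˢ range (m 0) | c.2 < m c.1} ↔ j < m i := by
    intro i j
    have := hanti (Nat.zero_le i)
    simp only [mem_filter, mem_product, Finsupp.mem_support_iff, mem_range]
    omega
  let μ : YoungDiagram :=
    { cells := {c ∈ m.support ×ˢ range (m 0) | c.2 < m c.1}
      isLowerSet := by
        rintro ⟨i, j⟩ ⟨i', j'⟩ ⟨hi : i' ≤ i, hj : j' ≤ j⟩ h
        rw [mem_coe, hmem] at h ⊢
        exact (hj.trans_lt h).trans_le (hanti hi) }
  refine ⟨μ, Finsupp.ext fun i => ?_⟩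
  rw [shapeWeight_apply]
  refine eq_of_forall_lt_iff fun j => ?_
  rw [← YoungDiagram.mem_iff_lt_rowLen, ← YoungDiagram.mem_cells, hmem]

/-- The statistic `∑ i, i * m i` of an exponent vector; on partitions it is strictly monotone for
the opposite of the dominance order. -/
noncomputable def depth : (ℕ →₀ ℕ) →+ ℕ :=
  Finsupp.weight (id : ℕ → ℕ)

theorem depth_single (i a : ℕ) : depth (Finsupp.single i a) = a * i := by
  simp [depth, Finsupp.weight_single]

variable {μ : YoungDiagram}

theorem depth_tableauWeight (T : SemistandardYoungTableau μ) :
    depth (tableauWeight T) = ∑ c ∈ μ.cells, T c.1 c.2 := by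
  simp [tableauWeight, depth_single]

theorem degree_tableauWeight (T : SemistandardYoungTableau μ) :
    (tableauWeight T).degree = μ.card := by
  simp [tableauWeight, Finsupp.degree_single]

theorem row_le_entry (T : SemistandardYoungTableau μ) {i j : ℕ} (h : (i, j) ∈ μ) : i ≤ T i j := by
  induction i with
  | zero => exact Nat.zero_le _
  | succ i ih =>
    exact (ih (μ.up_left_mem (Nat.le_succ i) le_rfl h)).trans_lt (T.col_strict (Nat.lt_succ_self i) h)

theorem highestWeight_le (T : SemistandardYoungTableau μ) :
    ∀ c ∈ μ.cells, SemistandardYoungTableau.highestWeight μ c.1 c.2 ≤ T c.1 c.2 := by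
  intro c hc
  rw [SemistandardYoungTableau.highestWeight_apply, if_pos (by simpa using hc)]
  exact row_le_entry T (by simpa using hc)

theorem depth_shapeWeight_le (T : SemistandardYoungTableau μ) :
    depth (shapeWeight μ) ≤ depth (tableauWeight T) := by
  rw [shapeWeight, depth_tableauWeight, depth_tableauWeight]
  exact Finset.sum_le_sum (highestWeight_le T)

theorem eq_highestWeight (T : SemistandardYoungTableau μ)
    (h : depth (tableauWeight T) = depth (shapeWeight μ)) :
    T = SemistandardYoungTableau.highestWeight μ := by
  rw [shapeWeight, depth_tableauWeight, depth_tableauWeight, eq_comm] at h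
  have key := (Finset.sum_eq_sum_iff_of_le (highestWeight_le T)).1 h
  ext i j
  by_cases hc : (i, j) ∈ μ
  · exact (key (i, j) (by simpa using hc)).symm
  · rw [T.zeros hc, SemistandardYoungTableau.zeros _ hc]

theorem exists_tableau_of_coeff_schur_ne_zero {m : ℕ →₀ ℕ}
    (h : MvPowerSeries.coeff m (schur μ) ≠ 0) :
    ∃ T : SemistandardYoungTableau μ, tableauWeight T = m := by
  by_contra! h'
  apply h
  have : IsEmpty {T : SemistandardYoungTableau μ // tableauWeight T = m} := ⟨fun T => h' T.1 T.2⟩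
  rw [schur, coeff_formalSum, Nat.card_of_isEmpty, Nat.cast_zero]

theorem coeff_schur_eq_zero_of_degree {m : ℕ →₀ ℕ} (h : m.degree ≠ μ.card) :
    MvPowerSeries.coeff m (schur μ) = 0 := by
  by_contra h'
  obtain ⟨T, rfl⟩ := exists_tableau_of_coeff_schur_ne_zero h'
  exact h (degree_tableauWeight T)

theorem coeff_schur_shapeWeight_self (μ : YoungDiagram) :
    MvPowerSeries.coeff (shapeWeight μ) (schur μ) = 1 := by
  have : Unique {T : SemistandardYoungTableau μ // tableauWeight T = shapeWeight μ} :=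
    { default := ⟨SemistandardYoungTableau.highestWeight μ, rfl⟩
      uniq := fun T => Subtype.ext (eq_highestWeight T.1 (by rw [T.2])) }
  rw [schur, coeff_formalSum, Nat.card_unique, Nat.cast_one]

/-- The Kostka number of `μ` and `ν` vanishes unless `ν = μ` or `ν` has greater depth. -/
theorem depth_lt_of_coeff_schur_ne_zero {ν : YoungDiagram}
    (h : MvPowerSeries.coeff (shapeWeight ν) (schur μ) ≠ 0) (hne : μ ≠ ν) :
    depth (shapeWeight μ) < depth (shapeWeight ν) := by
  obtain ⟨T, hT⟩ := exists_tableau_of_coeff_schur_ne_zero h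
  rw [← hT]
  refine lt_of_le_of_ne (depth_shapeWeight_le T) fun he => hne ?_
  rw [eq_highestWeight T he.symm] at hT
  exact shapeWeight_injective hT

/-- A square submatrix of the Kostka matrix, on any finite set of shapes, is unitriangular and hence
injective. -/
theorem eq_zero_of_sum_coeff_schur_eq_zero (s : Finset YoungDiagram) (c : YoungDiagram → ℚ)
    (h : ∀ ν ∈ s, ∑ μ ∈ s, c μ * MvPowerSeries.coeff (shapeWeight ν) (schur μ) = 0) :
    ∀ ν ∈ s, c ν = 0 := by
  intro ν hν
  induction hd : depth (shapeWeight ν) using Nat.strong_induction_on generalizing ν with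
  | _ d ih =>
    have := h ν hν
    rwa [Finset.sum_eq_single_of_mem ν hν, coeff_schur_shapeWeight_self, mul_one] at this
    intro μ hμ hne
    by_cases hz : MvPowerSeries.coeff (shapeWeight ν) (schur μ) = 0
    · rw [hz, mul_zero]
    · rw [ih _ (hd ▸ depth_lt_of_coeff_schur_ne_zero hz hne) μ hμ rfl, zero_mul]

theorem coeff_linearCombination_schur (c : YoungDiagram →₀ ℚ) (m : ℕ →₀ ℕ) :
    MvPowerSeries.coeff m (Finsupp.linearCombination ℚ schur c) =
      ∑ μ ∈ c.support, c μ * MvPowerSeries.coeff m (schur μ) := by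
  rw [Finsupp.linearCombination_apply, Finsupp.sum, map_sum]
  rfl

theorem linearIndependent_schur : LinearIndependent ℚ schur := by
  rw [linearIndependent_iff]
  intro c hc
  ext μ
  by_contra h
  refine h (eq_zero_of_sum_coeff_schur_eq_zero c.support c (fun ν _ => ?_) μ
    (Finsupp.mem_support_iff.2 h))
  rw [← coeff_linearCombination_schur, hc, map_zero]

/-! ### Schur expansions of symmetric power series -/

/-- Every exponent vector can be sorted by adjacent interchanges, so a symmetric series is
determined by its coefficients at partitions. -/
theorem eq_zero_of_coeff_shapeWeight_eq_zero {f : MvPowerSeries ℕ ℚ} (hf : IsSymmetricSeries f)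
    (h : ∀ μ, MvPowerSeries.coeff (shapeWeight μ) f = 0) : f = 0 := by
  ext m
  rw [map_zero]
  induction hd : depth m using Nat.strong_induction_on generalizing m with
  | _ d ih =>
    by_cases hm : ∀ k, m (k + 1) ≤ m k
    · obtain ⟨μ, rfl⟩ := exists_shapeWeight_eq hm
      exact h μ
    · push Not at hm
      obtain ⟨k, hk⟩ := hm
      rw [← hf k m]
      refine ih _ ?_ _ rfl
      obtain ⟨a, ha⟩ : ∃ a, m (k + 1) = m k + a := ⟨_, (Nat.add_sub_of_le hk.le).symm⟩
      have key : m.equivMapDomain (Equiv.swap k (k + 1)) + Finsupp.single (k + 1) a =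
          m + Finsupp.single k a := by
        ext l
        rw [Finsupp.add_apply, Finsupp.add_apply, Finsupp.equivMapDomain_apply, Equiv.symm_swap,
          Finsupp.single_apply, Finsupp.single_apply, Equiv.swap_apply_def]
        split_ifs <;> subst_vars <;> omega
      have := congrArg depth key
      rw [map_add, map_add, depth_single, depth_single, mul_add, mul_one] at this
      omega

theorem finite_setOf_card_eq (n : ℕ) : {μ : YoungDiagram | μ.card = n}.Finite := by
  refine Set.Finite.of_finite_image (f := YoungDiagram.cells)
    ((range n ×ˢ range n).powerset.finite_toSet.subset ?_)
    (fun μ _ ν _ h => YoungDiagram.ext h)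
  rintro _ ⟨μ, rfl : μ.card = n, rfl⟩
  rw [mem_coe, mem_powerset]
  rintro ⟨i, j⟩ h
  rw [YoungDiagram.mem_cells] at h
  have h1 := YoungDiagram.mem_iff_lt_colLen.1 (μ.up_left_mem le_rfl (Nat.zero_le j) h)
  have h2 := YoungDiagram.mem_iff_lt_rowLen.1 (μ.up_left_mem (Nat.zero_le i) le_rfl h)
  rw [YoungDiagram.colLen_eq_card] at h1
  rw [YoungDiagram.rowLen_eq_card] at h2
  rw [mem_product, mem_range, mem_range]
  exact ⟨h1.trans_le (card_le_card (filter_subset _ _)),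
    h2.trans_le (card_le_card (filter_subset _ _))⟩

theorem isSymmetricSeries_linearCombination_schur (c : YoungDiagram →₀ ℚ) :
    IsSymmetricSeries (Finsupp.linearCombination ℚ schur c) := by
  intro k m
  rw [coeff_linearCombination_schur, coeff_linearCombination_schur]
  exact Finset.sum_congr rfl fun μ _ => by rw [isSymmetricSeries_schur μ k m]

/-- A homogeneous symmetric power series has a Schur expansion: the square Kostka matrix is
injective, hence surjective, so that a combination of Schur functions with the right coefficients
at all partitions exists. -/
theorem exists_isSchurExpansion {f : MvPowerSeries ℕ ℚ} (hf : IsSymmetricSeries f) {n : ℕ}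
    (hdeg : ∀ m : ℕ →₀ ℕ, m.degree ≠ n → MvPowerSeries.coeff m f = 0) :
    ∃ c, IsSchurExpansion f c := by
  classical
  set s := (finite_setOf_card_eq n).toFinset with hs
  have hmem : ∀ μ, μ ∈ s ↔ μ.card = n := fun μ => by simp [hs]
  let K : (s → ℚ) →ₗ[ℚ] (s → ℚ) :=
    Matrix.mulVecLin (Matrix.of fun ν μ : s => MvPowerSeries.coeff (shapeWeight ν.1) (schur μ.1))
  have hK : ∀ (g : YoungDiagram → ℚ) (ν : s), K (fun μ => g μ.1) ν =
      ∑ μ ∈ s, g μ * MvPowerSeries.coeff (shapeWeight ν.1) (schur μ) := by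
    intro g ν
    rw [← Finset.sum_coe_sort s]
    exact Finset.sum_congr rfl fun μ _ => mul_comm _ _
  have hext : ∀ c : s → ℚ, ∃ g : YoungDiagram → ℚ, c = fun μ => g μ.1 := fun c =>
    ⟨fun μ => if h : μ ∈ s then c ⟨μ, h⟩ else 0, funext fun μ => by simp⟩
  have hinj : Function.Injective K := by
    rw [← LinearMap.ker_eq_bot, LinearMap.ker_eq_bot']
    intro c hc
    obtain ⟨g, rfl⟩ := hext c
    funext ν
    refine eq_zero_of_sum_coeff_schur_eq_zero s g (fun ν hν => ?_) ν.1 ν.2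
    rw [← hK g ⟨ν, hν⟩, hc]
    rfl
  obtain ⟨c, hc⟩ := LinearMap.injective_iff_surjective.1 hinj
    (fun ν => MvPowerSeries.coeff (shapeWeight ν.1) f)
  obtain ⟨g, rfl⟩ := hext c
  have hg : ∀ μ, (if μ ∈ s then g μ else 0) ≠ 0 → μ ∈ s := fun μ h =>
    by_contra fun h' => h (if_neg h')
  refine ⟨Finsupp.onFinset s _ hg, ?_⟩
  set c := Finsupp.onFinset s _ hg with hc'
  rw [IsSchurExpansion, ← sub_eq_zero]
  refine eq_zero_of_coeff_shapeWeight_eq_zero (fun k m => ?_) fun ν => ?_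
  · rw [map_sub, map_sub, hf k m, isSymmetricSeries_linearCombination_schur c k m]
  · have hsum : MvPowerSeries.coeff (shapeWeight ν) (Finsupp.linearCombination ℚ schur c) =
        ∑ μ ∈ s, g μ * MvPowerSeries.coeff (shapeWeight ν) (schur μ) := by
      rw [coeff_linearCombination_schur]
      refine (Finset.sum_subset Finsupp.support_onFinset_subset fun μ _ h => ?_).trans
        (Finset.sum_congr rfl fun μ hμ => ?_)
      · rw [Finsupp.notMem_support_iff.1 h, zero_mul]
      · rw [hc', Finsupp.onFinset_apply, if_pos hμ]
    rw [map_sub, hsum]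
    by_cases hν : ν ∈ s
    · rw [← hK g ⟨ν, hν⟩, hc, sub_self]
    · have hd : (shapeWeight ν).degree ≠ n := by
        rwa [shapeWeight, degree_tableauWeight, Ne, ← hmem]
      rw [hdeg _ hd, Finset.sum_eq_zero, sub_zero]
      intro μ hμ
      rw [coeff_schur_eq_zero_of_degree (by rwa [(hmem μ).1 hμ]), mul_zero]

end

section

/-! ### Sums of fundamental quasisymmetric functions -/

/-- The coefficients of `∑ x, F_{d x}` count the pairs of some `x` and an admissible word. -/
theorem coeff_sum_fundamental {X : Type} [Fintype X] {n : ℕ} (d : X → Set ℕ) (m : ℕ →₀ ℕ) :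
    MvPowerSeries.coeff m (∑ x, fundamental n (d x)) =
      (Nat.card {p : X × (Fin n → ℕ) // (Monotone p.2 ∧
        ∀ a b : Fin n, (a : ℕ) + 1 = (b : ℕ) → (b : ℕ) ∈ d p.1 → p.2 a < p.2 b) ∧
        ∑ j, Finsupp.single (p.2 j) 1 = m} : ℚ) := by
  have : ∀ x, Finite {w : FundamentalWord n (d x) // w.weight = m} :=
    fun x => finite_words n (d x) m
  rw [map_sum]
  simp only [fundamental, coeff_formalSum]
  rw [← Nat.cast_sum, ← Nat.card_sigma]
  congr 1
  exact Nat.card_congr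
    { toFun := fun q => ⟨(q.1, q.2.1.1), q.2.1.2, q.2.2⟩
      invFun := fun p => ⟨p.1.1, ⟨⟨p.1.2, p.2.1⟩, p.2.2⟩⟩
      left_inv := fun _ => rfl
      right_inv := fun _ => rfl }

variable {n : ℕ}

theorem weight_apply (w : Fin n → ℕ) (l : ℕ) :
    (∑ j, Finsupp.single (w j) 1 : ℕ →₀ ℕ) l = #{j | w j = l} := by
  rw [Finsupp.finsetSum_apply, Finset.card_filter]
  exact Finset.sum_congr rfl fun c _ => by rw [Finsupp.single_apply]

theorem coeff_fundamental_eq_zero_of_degree {I : Set ℕ} {m : ℕ →₀ ℕ} (hm : m.degree ≠ n) :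
    MvPowerSeries.coeff m (fundamental n I) = 0 := by
  have : IsEmpty {w : FundamentalWord n I // w.weight = m} := by
    refine ⟨fun w => hm ?_⟩
    rw [← w.2, FundamentalWord.weight]
    simp [Finsupp.degree_single]
  rw [fundamental, coeff_formalSum, Nat.card_of_isEmpty, Nat.cast_zero]

/-! ### Symmetry of the Rédei–Berge function -/

theorem succ_mem_descents {D : Digraph (Fin n)} {π : Equiv.Perm (Fin n)} {a b : Fin n}
    (h : (a : ℕ) + 1 = b) : (b : ℕ) ∈ descents D π ↔ D.Adj (π a) (π b) := by
  constructor
  · rintro ⟨a', b', ha, hb, hadj⟩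
    rwa [Fin.ext (show (a : ℕ) = a' by omega), Fin.ext (hb.symm)]
  · exact fun hadj => ⟨a, b, h, rfl, hadj⟩

/-- If a word is recoloured by `s` and stably sorted by the new colours, then positions which
become adjacent and have the same colour were adjacent before. -/
theorem sort_succ_of_eq {s : Equiv.Perm ℕ} {w : Fin n → ℕ} (hw : Monotone w) {a b : Fin n}
    (hab : (a : ℕ) + 1 = b) (h : w (Tuple.sort (s ∘ w) a) = w (Tuple.sort (s ∘ w) b)) :
    (Tuple.sort (s ∘ w) a : ℕ) + 1 = Tuple.sort (s ∘ w) b := by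
  set τ := Tuple.sort (s ∘ w) with hτ
  obtain ⟨-, hst⟩ := Tuple.eq_sort_iff.1 hτ
  have hlt : τ a < τ b := hst a b (Fin.lt_def.2 (by omega)) (congrArg s h)
  obtain ⟨c, hc⟩ := τ.surjective ⟨(τ a : ℕ) + 1, by have := (τ b).2; have := Fin.lt_def.1 hlt; omega⟩
  have hcv : (τ c : ℕ) = τ a + 1 := by rw [hc]
  have hac : τ a < τ c := Fin.lt_def.2 (by omega)
  have hcb : τ c ≤ τ b := Fin.le_def.2 (by have := Fin.lt_def.1 hlt; omega)
  have hwc : w (τ a) = w (τ c) := le_antisymm (hw hac.le) (h ▸ hw hcb)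
  have h1 : a < c := by
    rcases lt_trichotomy a c with h' | rfl | h'
    · exact h'
    · exact absurd hac (lt_irrefl _)
    · exact absurd (hst c a h' (congrArg s hwc.symm)) hac.not_gt
  have h2 : c ≤ b := by
    by_contra h'
    exact absurd (hst b c (not_le.1 h') (congrArg s (h.symm.trans hwc))) hcb.not_gt
  have : c = b := Fin.ext (by have := Fin.lt_def.1 h1; have := Fin.le_def.1 h2; omega)
  rw [← this, hcv]

theorem sort_mul_sort (s : Equiv.Perm ℕ) {w : Fin n → ℕ} (hw : Monotone w) :
    Tuple.sort (s ∘ w) * Tuple.sort (w ∘ Tuple.sort (s ∘ w)) = 1 := by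
  set τ := Tuple.sort (s ∘ w) with hτ
  set τ' := Tuple.sort (w ∘ τ) with hτ'
  obtain ⟨-, h1⟩ := Tuple.eq_sort_iff.1 hτ
  obtain ⟨h2, h3⟩ := Tuple.eq_sort_iff.1 hτ'
  have : τ * τ' = Tuple.sort w :=
    Tuple.eq_sort_iff.2 ⟨h2, fun i j hij h => h1 _ _ (h3 i j hij h) (congrArg s h)⟩
  rw [this, Tuple.sort_eq_refl_iff_monotone.2 hw]
  rfl

theorem sum_single_comp (s : Equiv.Perm ℕ) (w : Fin n → ℕ) (τ : Equiv.Perm (Fin n)) :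
    (∑ j, Finsupp.single (s (w (τ j))) 1 : ℕ →₀ ℕ) =
      (∑ j, Finsupp.single (w j) 1 : ℕ →₀ ℕ).equivMapDomain s := by
  rw [Equiv.sum_comp τ (fun j => (Finsupp.single (s (w j)) 1 : ℕ →₀ ℕ)),
    Finsupp.equivMapDomain_eq_mapDomain, Finsupp.mapDomain_finsetSum]
  exact Finset.sum_congr rfl fun j _ => by rw [Finsupp.mapDomain_single]

/-- The coefficient of `z ^ m` in `U_D` counts the ways to distribute the vertices to colours, `m k`
of them to each colour `k`, and to arrange each colour class in a path of the complement of `D`.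
This does not depend on the order of the colours: here the colours are permuted by stably sorting
the recoloured word. -/
theorem isSymmetricSeries_redeiBerge (D : Digraph (Fin n)) : IsSymmetricSeries (redeiBerge D) := by
  intro k m
  rw [redeiBerge, coeff_sum_fundamental, coeff_sum_fundamental]
  congr 1
  set s := Equiv.swap k (k + 1) with hs
  have hss : ∀ x, s (s x) = x := Equiv.swap_apply_self k (k + 1)
  let P : (ℕ →₀ ℕ) → Equiv.Perm (Fin n) × (Fin n → ℕ) → Prop := fun m p =>
    (Monotone p.2 ∧ ∀ a b : Fin n, (a : ℕ) + 1 = (b : ℕ) → (b : ℕ) ∈ descents D p.1 →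
      p.2 a < p.2 b) ∧ ∑ j, Finsupp.single (p.2 j) 1 = m
  let Φ : Equiv.Perm (Fin n) × (Fin n → ℕ) → Equiv.Perm (Fin n) × (Fin n → ℕ) := fun p =>
    (p.1 * Tuple.sort (s ∘ p.2), s ∘ p.2 ∘ Tuple.sort (s ∘ p.2))
  have hΦ : ∀ m p, P m p → P (m.equivMapDomain s) (Φ p) := by
    rintro m ⟨π, w⟩ ⟨⟨hw, hd⟩, hm⟩
    have hmono := Tuple.monotone_sort (s ∘ w)
    refine ⟨⟨hmono, fun a b hab hmem => ?_⟩, ?_⟩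
    · refine lt_of_le_of_ne (hmono (Fin.le_def.2 (by omega))) fun he => ?_
      have he' : w (Tuple.sort (s ∘ w) a) = w (Tuple.sort (s ∘ w) b) := s.injective he
      have hsucc := sort_succ_of_eq hw hab he'
      exact (hd _ _ hsucc ((succ_mem_descents hsucc).2 ((succ_mem_descents hab).1 hmem))).ne he'
    · rw [← hm]
      exact sum_single_comp s w _
  have hΦΦ : ∀ m p, P m p → Φ (Φ p) = p := by
    rintro m ⟨π, w⟩ ⟨⟨hw, -⟩, -⟩
    have h1 : s ∘ s ∘ w ∘ Tuple.sort (s ∘ w) = w ∘ Tuple.sort (s ∘ w) := funext fun x => hss _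
    have h2 := sort_mul_sort s hw
    refine Prod.ext ?_ ?_
    · change π * Tuple.sort (s ∘ w) * Tuple.sort (s ∘ s ∘ w ∘ Tuple.sort (s ∘ w)) = π
      rw [h1, mul_assoc, h2, mul_one]
    · funext j
      change s (s (w ((Tuple.sort (s ∘ w) * Tuple.sort (s ∘ s ∘ w ∘ Tuple.sort (s ∘ w))) j))) = w j
      rw [h1, h2, hss]
      rfl
  have hΦ' : ∀ p, P (m.equivMapDomain s) p → P m (Φ p) := fun p hp => by
    have := hΦ _ p hp
    rwa [equivMapDomain_swap_swap] at this
  exact Nat.card_congr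
    { toFun := fun p => ⟨Φ p.1, hΦ' p.1 p.2⟩
      invFun := fun p => ⟨Φ p.1, hΦ _ p.1 p.2⟩
      left_inv := fun p => Subtype.ext (hΦΦ _ p.1 p.2)
      right_inv := fun p => Subtype.ext (hΦΦ _ p.1 p.2) }

theorem coeff_redeiBerge_eq_zero_of_degree (D : Digraph (Fin n)) {m : ℕ →₀ ℕ} (hm : m.degree ≠ n) :
    MvPowerSeries.coeff m (redeiBerge D) = 0 := by
  rw [redeiBerge, map_sum]
  exact Finset.sum_eq_zero fun π _ => coeff_fundamental_eq_zero_of_degree hm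

end

section

variable {n : ℕ}

/-! ### Extracting the coefficients of fundamental quasisymmetric functions -/

/-- A weakly increasing word is determined by its exponent vector. -/
theorem eq_of_monotone_of_weight_eq {w w' : Fin n → ℕ} (hw : Monotone w) (hw' : Monotone w')
    (h : (∑ j, Finsupp.single (w j) 1 : ℕ →₀ ℕ) = ∑ j, Finsupp.single (w' j) 1) : w = w' := by
  have hcard : ∀ (v : Fin n → ℕ) (l : ℕ),
      #{j | v j < l} = ∑ x ∈ range l, (∑ j, Finsupp.single (v j) 1 : ℕ →₀ ℕ) x := by
    intro v l
    rw [Finset.card_eq_sum_card_fiberwise (f := v) (t := range l) (fun j hj => by simpa using hj)]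
    refine Finset.sum_congr rfl fun x hx => ?_
    rw [weight_apply, Finset.filter_filter]
    congr 1
    ext j
    have := mem_range.1 hx
    simp only [mem_filter, mem_univ, true_and]
    omega
  funext j
  refine eq_of_forall_gt_iff fun l => ?_
  rw [← Tuple.lt_card_lt_iff_apply_lt_of_monotone hw,
    ← Tuple.lt_card_lt_iff_apply_lt_of_monotone hw', hcard, hcard, h]

/-- The weakly increasing word of length `n`, starting with `0` if `0 ∉ J`, which increases by one
at the positions in `J` and is constant elsewhere. -/
def stepWord (n : ℕ) (J : Finset ℕ) (p : Fin n) : ℕ :=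
  #{j ∈ J | j ≤ (p : ℕ)}

theorem monotone_stepWord (J : Finset ℕ) : Monotone (stepWord n J) := fun p q hpq =>
  card_le_card fun j hj => by
    have := Fin.le_def.1 hpq
    simp only [mem_filter] at hj ⊢
    exact ⟨hj.1, by omega⟩

theorem stepWord_lt_iff (J : Finset ℕ) {a b : Fin n} (hab : (a : ℕ) + 1 = b) :
    stepWord n J a < stepWord n J b ↔ (b : ℕ) ∈ J := by
  constructor
  · intro h
    by_contra hb
    refine h.not_ge (card_le_card fun j hj => ?_)
    simp only [mem_filter] at hj ⊢
    have : j ≠ b := fun h => hb (h ▸ hj.1)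
    exact ⟨hj.1, by omega⟩
  · intro hb
    refine card_lt_card ((ssubset_iff_of_subset fun j hj => ?_).2 ⟨b, ?_, ?_⟩)
    · simp only [mem_filter] at hj ⊢
      exact ⟨hj.1, by omega⟩
    · simp [hb]
    · simp only [mem_filter]
      omega

open Classical in
theorem coeff_stepWord_fundamental (J : Finset ℕ) {K : Set ℕ} (hK : K ⊆ Set.Ico 1 n) :
    MvPowerSeries.coeff (∑ j, Finsupp.single (stepWord n J j) 1) (fundamental n K) =
      if K ⊆ J then 1 else 0 := by
  have huniq : ∀ w : FundamentalWord n K,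
      w.weight = ∑ j, Finsupp.single (stepWord n J j) 1 → w.1 = stepWord n J := fun w hw =>
    eq_of_monotone_of_weight_eq w.2.1 (monotone_stepWord J) hw
  rw [fundamental, coeff_formalSum]
  split_ifs with h
  · have : Unique {w : FundamentalWord n K //
        w.weight = ∑ j, Finsupp.single (stepWord n J j) 1} :=
      { default := ⟨⟨stepWord n J, monotone_stepWord J,
          fun a b hab hb => (stepWord_lt_iff J hab).2 (h hb)⟩, rfl⟩
        uniq := fun w => Subtype.ext (Subtype.ext (huniq w.1 w.2)) }
    rw [Nat.card_unique, Nat.cast_one]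
  · have : IsEmpty {w : FundamentalWord n K //
        w.weight = ∑ j, Finsupp.single (stepWord n J j) 1} := by
      refine ⟨fun w => h fun b hb => ?_⟩
      obtain ⟨h1, h2⟩ := hK hb
      have hlt := w.1.2.2 ⟨b - 1, by omega⟩ ⟨b, h2⟩ (Nat.sub_add_cancel h1) hb
      rw [huniq w.1 w.2] at hlt
      exact (stepWord_lt_iff (a := ⟨b - 1, by omega⟩) (b := ⟨b, h2⟩) J
        (Nat.sub_add_cancel h1)).1 hlt
    rw [Nat.card_of_isEmpty, Nat.cast_zero]

open Classical in
/-- There is a linear functional which extracts the coefficient of `F_I` from a combination of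
fundamental quasisymmetric functions of degree `n`. -/
theorem exists_fundamental_functional (n : ℕ) (I : Finset ℕ) :
    ∃ φ : MvPowerSeries ℕ ℚ →ₗ[ℚ] ℚ,
      (∀ K : Set ℕ, K ⊆ Set.Ico 1 n → φ (fundamental n K) = if K = I then 1 else 0) ∧
      ∀ f, (∀ m : ℕ →₀ ℕ, m.degree = n → MvPowerSeries.coeff m f = 0) → φ f = 0 := by
  induction I using Finset.strongInduction with
  | H I ih =>
    choose! φ hφ hφ' using ih
    refine ⟨MvPowerSeries.coeff (∑ j, Finsupp.single (stepWord n I j) 1) -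
      ∑ J ∈ I.ssubsets, φ J, fun K hK => ?_, fun f hf => ?_⟩
    · rw [LinearMap.sub_apply, LinearMap.sum_apply, coeff_stepWord_fundamental I hK,
        Finset.sum_congr rfl fun J hJ => hφ J (mem_ssubsets.1 hJ) K hK]
      by_cases hKI : K ⊆ I
      · lift K to Finset ℕ using I.finite_toSet.subset hKI
        simp only [coe_inj, Finset.sum_ite_eq, mem_ssubsets]
        rw [if_pos hKI]
        rw [coe_subset] at hKI
        by_cases he : K = I
        · simp [he]
        · simp [he, hKI.ssubset_of_ne he]
      · rw [if_neg hKI, if_neg fun h => hKI h.subset, Finset.sum_eq_zero, sub_zero]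
        intro J hJ
        rw [if_neg]
        rintro rfl
        exact hKI (coe_subset.2 (mem_ssubsets.1 hJ).subset)
    · rw [LinearMap.sub_apply, LinearMap.sum_apply, hf _ (by simp [Finsupp.degree_single]),
        Finset.sum_eq_zero fun J hJ => hφ' J (mem_ssubsets.1 hJ) f hf, sub_zero]

/-! ### Standardization of semistandard tableaux -/

/-- A standard Young tableau with `n` cells, as the list of its cells in the order of their
entries: a cell weakly above and weakly left of another one comes first. -/
abbrev StandardTableau (n : ℕ) (μ : YoungDiagram) : Type :=
  {π : Fin n ≃ μ.cells // ∀ a b, (π a).1 ≤ (π b).1 → a ≤ b}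

/-- The descents of a standard tableau: `i` is a descent if the entry `i + 1` is not in a column to
the right of the column of `i`.  The entry `i` belongs to the element `i - 1` of `Fin n`. -/
def columnDescents {μ : YoungDiagram} (π : Fin n ≃ μ.cells) : Set ℕ :=
  {i | ∃ a b : Fin n, (a : ℕ) + 1 = i ∧ (b : ℕ) = i ∧ (π b).1.2 ≤ (π a).1.2}

theorem columnDescents_subset {μ : YoungDiagram} (π : Fin n ≃ μ.cells) :
    columnDescents π ⊆ Set.Ico 1 n := by
  rintro i ⟨a, b, ha, hb, -⟩
  exact ⟨by omega, hb ▸ b.2⟩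

theorem descents_subset (D : Digraph (Fin n)) (π : Equiv.Perm (Fin n)) :
    descents D π ⊆ Set.Ico 1 n := by
  rintro i ⟨a, b, ha, hb, -⟩
  exact ⟨by omega, hb ▸ b.2⟩

theorem succ_mem_columnDescents {μ : YoungDiagram} {π : Fin n ≃ μ.cells} {a b : Fin n}
    (h : (a : ℕ) + 1 = b) : (b : ℕ) ∈ columnDescents π ↔ (π b).1.2 ≤ (π a).1.2 := by
  constructor
  · rintro ⟨a', b', ha, hb, hle⟩
    rwa [Fin.ext (show (a : ℕ) = a' by omega), Fin.ext (hb.symm)]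
  · exact fun hle => ⟨a, b, h, rfl, hle⟩

variable {μ : YoungDiagram}

/-- If `w` increases strictly at the descents of `π`, then the columns increase strictly along
the positions on which `w` is constant. -/
theorem col_lt_of_word_eq {π : Fin n ≃ μ.cells} {w : Fin n → ℕ} (hw : Monotone w)
    (hd : ∀ a b : Fin n, (a : ℕ) + 1 = b → (b : ℕ) ∈ columnDescents π → w a < w b)
    {a b : Fin n} (hab : a < b) (h : w a = w b) : (π a).1.2 < (π b).1.2 := by
  obtain ⟨b, hb⟩ := b
  have hab' : (a : ℕ) + 1 ≤ b := hab
  clear hab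
  induction b, hab' using Nat.le_induction with
  | base =>
    by_contra hle
    exact (hd a ⟨a + 1, hb⟩ rfl ((succ_mem_columnDescents rfl).2 (not_lt.1 hle))).ne h
  | succ b hab ih =>
    have hb' : b < n := by omega
    have h1 : w a ≤ w ⟨b, hb'⟩ := hw (Fin.le_def.2 (by simp only; omega))
    have h2 : w ⟨b, hb'⟩ ≤ w ⟨b + 1, hb⟩ := hw (Fin.le_def.2 (by simp only; omega))
    refine (ih hb' (by omega)).trans ?_
    by_contra hle
    have := hd ⟨b, hb'⟩ ⟨b + 1, hb⟩ rfl ((succ_mem_columnDescents rfl).2 (not_lt.1 hle))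
    omega

/-- The semistandard tableau with the entry `w a` in the cell number `a` of a standard tableau. -/
def tableauOfWord (π : StandardTableau n μ) (w : Fin n → ℕ) (hw : Monotone w)
    (hd : ∀ a b : Fin n, (a : ℕ) + 1 = b → (b : ℕ) ∈ columnDescents π.1 → w a < w b) :
    SemistandardYoungTableau μ where
  entry i j := if h : (i, j) ∈ μ.cells then w (π.1.symm ⟨(i, j), h⟩) else 0
  row_weak' := by
    intro i j₁ j₂ hj hc
    have hc' := μ.up_left_mem le_rfl hj.le hc
    rw [← YoungDiagram.mem_cells] at hc hc'
    rw [dif_pos hc, dif_pos hc']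
    exact hw (π.2 _ _ (by simpa using hj.le))
  col_strict' := by
    intro i₁ i₂ j hi hc
    have hc' := μ.up_left_mem hi.le le_rfl hc
    rw [← YoungDiagram.mem_cells] at hc hc'
    rw [dif_pos hc, dif_pos hc']
    have hle : π.1.symm ⟨(i₁, j), hc'⟩ ≤ π.1.symm ⟨(i₂, j), hc⟩ :=
      π.2 _ _ (by simpa using hi.le)
    refine lt_of_le_of_ne (hw hle) fun he => ?_
    have hne : π.1.symm ⟨(i₁, j), hc'⟩ ≠ π.1.symm ⟨(i₂, j), hc⟩ := by
      simpa using hi.ne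
    simpa using col_lt_of_word_eq hw hd (lt_of_le_of_ne hle hne) he
  zeros' := by
    intro i j hc
    rw [dif_neg (by simpa using hc)]

theorem tableauOfWord_apply (π : StandardTableau n μ) (w : Fin n → ℕ) (hw : Monotone w)
    (hd : ∀ a b : Fin n, (a : ℕ) + 1 = b → (b : ℕ) ∈ columnDescents π.1 → w a < w b) (a : Fin n) :
    tableauOfWord π w hw hd (π.1 a).1.1 (π.1 a).1.2 = w a := by
  change (if h : ((π.1 a).1.1, (π.1 a).1.2) ∈ μ.cells then _ else 0) = _
  rw [dif_pos (π.1 a).2]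
  simp

theorem tableauWeight_eq_sum (T : SemistandardYoungTableau μ) (π : Fin n ≃ μ.cells) :
    tableauWeight T = ∑ a, Finsupp.single (T (π a).1.1 (π a).1.2) 1 := by
  rw [tableauWeight, ← Finset.sum_coe_sort,
    ← Equiv.sum_comp π (fun c : μ.cells => (Finsupp.single (T c.1.1 c.1.2) 1 : ℕ →₀ ℕ))]

/-- The order in which standardization reads the cells of a semistandard tableau: by entries, and
cells with equal entries from left to right. -/
def readingKey (T : SemistandardYoungTableau μ) (c : ℕ × ℕ) : ℕ ×ₗ ℕ :=
  toLex (T c.1 c.2, c.2)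

theorem readingKey_injOn (T : SemistandardYoungTableau μ) {c c' : ℕ × ℕ} (hc : c ∈ μ.cells)
    (hc' : c' ∈ μ.cells) (h : readingKey T c = readingKey T c') : c = c' := by
  obtain ⟨i, j⟩ := c
  obtain ⟨i', j'⟩ := c'
  obtain ⟨h1, rfl⟩ : T i j = T i' j' ∧ j = j' := by simpa [readingKey] using h
  rw [YoungDiagram.mem_cells] at hc hc'
  rcases lt_trichotomy i i' with hi | rfl | hi
  · exact absurd h1 (T.col_strict hi hc').ne
  · rfl
  · exact absurd h1 (T.col_strict hi hc).ne'

theorem readingKey_mono (T : SemistandardYoungTableau μ) {c c' : ℕ × ℕ}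
    (hc' : c' ∈ μ.cells) (h : c ≤ c') : readingKey T c ≤ readingKey T c' := by
  obtain ⟨i, j⟩ := c
  obtain ⟨i', j'⟩ := c'
  obtain ⟨hi, hj⟩ : i ≤ i' ∧ j ≤ j' := h
  rw [YoungDiagram.mem_cells] at hc'
  have hT : T i j ≤ T i' j' :=
    (T.col_weak hi (μ.up_left_mem le_rfl hj hc')).trans (T.row_weak_of_le hj hc')
  rw [readingKey, readingKey, Prod.Lex.toLex_le_toLex]
  rcases hT.lt_or_eq with h | h
  · exact Or.inl h
  · exact Or.inr ⟨h, hj⟩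

theorem readingKey_tableauOfWord (π : StandardTableau n μ) (w : Fin n → ℕ) (hw : Monotone w)
    (hd : ∀ a b : Fin n, (a : ℕ) + 1 = b → (b : ℕ) ∈ columnDescents π.1 → w a < w b) :
    StrictMono fun a => readingKey (tableauOfWord π w hw hd) (π.1 a).1 := by
  intro a b hab
  simp only [readingKey, tableauOfWord_apply]
  rw [Prod.Lex.toLex_lt_toLex]
  rcases (hw hab.le).lt_or_eq with h | h
  · exact Or.inl h
  · exact Or.inr ⟨h, col_lt_of_word_eq hw hd hab h⟩

/-- At most one enumeration of the cells is increasing for a given injective order. -/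
theorem eq_of_strictMono_comp {α β : Type*} [Preorder β] {e e' : Fin n ≃ α} {f : α → β}
    (h : StrictMono fun a => f (e a)) (h' : StrictMono fun a => f (e' a)) : e = e' := by
  have hmono : StrictMono (e'.symm ∘ e) := by
    intro a b hab
    have h1 := h hab
    by_contra hle
    have h2 := h'.monotone (not_lt.1 hle)
    simp only [Function.comp_apply, Equiv.apply_symm_apply] at h1 h2
    exact h1.not_ge h2
  have h1 : e.trans e'.symm = 1 := (Equiv.Perm.monotone_iff _).1 hmono.monotone
  ext a
  have := Equiv.congr_fun h1 a
  simpa [Equiv.symm_apply_eq] using this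

theorem exists_standardization (hμ : μ.card = n) (T : SemistandardYoungTableau μ) :
    ∃ π : Fin n ≃ μ.cells, StrictMono fun a => readingKey T (π a).1 := by
  let e : Fin n ≃ μ.cells := (finCongr hμ.symm).trans μ.cells.equivFin.symm
  let τ := Tuple.sort fun a => readingKey T (e a).1
  refine ⟨τ.trans e, Monotone.strictMono_of_injective
    (Tuple.monotone_sort fun a => readingKey T (e a).1) fun a b h => ?_⟩
  exact (τ.trans e).injective
    (Subtype.ext (readingKey_injOn T ((τ.trans e) a).2 ((τ.trans e) b).2 h))

noncomputable instance : Fintype (StandardTableau n μ) := Fintype.ofFinite _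

/-- The expansion of a Schur function in fundamental quasisymmetric functions. -/
theorem schur_eq_sum_fundamental (hμ : μ.card = n) :
    schur μ = ∑ π : StandardTableau n μ, fundamental n (columnDescents π.1) := by
  ext m
  rw [coeff_sum_fundamental, schur, coeff_formalSum]
  congr 1
  symm
  refine Nat.card_congr (Equiv.ofBijective
    (fun p => ⟨tableauOfWord p.1.1 p.1.2 p.2.1.1 p.2.1.2, ?_⟩) ⟨?_, ?_⟩)
  · rw [tableauWeight_eq_sum _ p.1.1.1]
    simp only [tableauOfWord_apply]
    exact p.2.2
  · rintro ⟨⟨π, w⟩, ⟨hw, hd⟩, hm⟩ ⟨⟨π', w'⟩, ⟨hw', hd'⟩, hm'⟩ h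
    have h : tableauOfWord π w hw hd = tableauOfWord π' w' hw' hd' := congrArg Subtype.val h
    have hπ : π = π' := by
      refine Subtype.ext (eq_of_strictMono_comp (f := fun c => readingKey _ c.1)
        (readingKey_tableauOfWord π w hw hd) ?_)
      rw [h]
      exact readingKey_tableauOfWord π' w' hw' hd'
    subst hπ
    have hww : w = w' := funext fun a => by
      rw [← tableauOfWord_apply π w hw hd a, h, tableauOfWord_apply]
    subst hww
    rfl
  · rintro ⟨T, hT⟩
    obtain ⟨π, hπ⟩ := exists_standardization hμ T
    have hlex : ∀ a b, a < b → T (π a).1.1 (π a).1.2 < T (π b).1.1 (π b).1.2 ∨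
        T (π a).1.1 (π a).1.2 = T (π b).1.1 (π b).1.2 ∧ (π a).1.2 < (π b).1.2 := fun a b hab =>
      Prod.Lex.toLex_lt_toLex.1 (hπ hab)
    have hstd : ∀ a b, (π a).1 ≤ (π b).1 → a ≤ b := fun a b hab =>
      hπ.le_iff_le.1 (readingKey_mono T (π b).2 hab)
    have hw : Monotone fun a => T (π a).1.1 (π a).1.2 := by
      intro a b hab
      rcases hab.lt_or_eq with h | rfl
      · rcases hlex a b h with h | h
        · exact h.le
        · exact h.1.le
      · exact le_rfl
    have hd : ∀ a b : Fin n, (a : ℕ) + 1 = b → (b : ℕ) ∈ columnDescents π →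
        T (π a).1.1 (π a).1.2 < T (π b).1.1 (π b).1.2 := by
      intro a b hab hmem
      have := (succ_mem_columnDescents hab).1 hmem
      rcases hlex a b (Fin.lt_def.2 (by omega)) with h | h
      · exact h
      · exact absurd h.2 this.not_gt
    refine ⟨⟨(⟨π, hstd⟩, fun a => T (π a).1.1 (π a).1.2), ⟨hw, hd⟩, ?_⟩, Subtype.ext ?_⟩
    · rw [← tableauWeight_eq_sum, hT]
    · ext i j
      by_cases hc : (i, j) ∈ μ.cells
      · obtain ⟨a, ha⟩ := π.surjective ⟨(i, j), hc⟩
        have h1 : (π a).1.1 = i := by rw [ha]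
        have h2 : (π a).1.2 = j := by rw [ha]
        rw [← h1, ← h2]
        exact tableauOfWord_apply ⟨π, hstd⟩ _ hw hd a
      · rw [YoungDiagram.mem_cells] at hc
        rw [T.zeros hc, SemistandardYoungTableau.zeros _ hc]

end

section

variable {n : ℕ} {μ : YoungDiagram}

/-! ### Standard tableaux of hook shape -/

theorem mem_hook {i k : ℕ} (hi : 1 ≤ i) {r c : ℕ} :
    (r, c) ∈ hook i k hi ↔ r = 0 ∧ c < i ∨ 1 ≤ r ∧ r ≤ k ∧ c = 0 := by
  rw [hook, YoungDiagram.mem_ofRowLens]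
  cases r with
  | zero => simp
  | succ r =>
    simp only [List.length_cons, List.length_replicate, List.getElem_cons_succ,
      List.getElem_replicate, exists_prop]
    omega

/-- The cell with entry `p + 1` in the standard tableau of hook shape which first fills the first
row, of length `i`, and then the first column. -/
def hookCell (i p : ℕ) : ℕ × ℕ :=
  if p < i then (0, p) else (p + 1 - i, 0)

theorem hookCell_of_lt {i p : ℕ} (h : p < i) : hookCell i p = (0, p) := if_pos h

theorem hookCell_of_le {i p : ℕ} (h : i ≤ p) : hookCell i p = (p + 1 - i, 0) := if_neg h.not_gt

/-- If the descents of a standard tableau are exactly the positions from `i` on, then its first `i`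
entries must go to the right in the first row, and the others down in the first column. -/
theorem eq_hookCell {i : ℕ} (hi : 1 ≤ i) (π : StandardTableau n μ)
    (h : columnDescents π.1 = {j : ℕ | i ≤ j ∧ j ≤ n - 1}) (p : Fin n) :
    (π.1 p).1 = hookCell i p := by
  obtain ⟨p, hp⟩ := p
  induction p using Nat.strong_induction_on with
  | _ p ih =>
  obtain ⟨r, c, hrc⟩ : ∃ r c, (π.1 ⟨p, hp⟩).1 = (r, c) := ⟨_, _, rfl⟩
  have hmem : (r, c) ∈ μ := by
    rw [← hrc, ← YoungDiagram.mem_cells]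
    exact (π.1 ⟨p, hp⟩).2
  -- smaller cells come before `(r, c)`, and so they are known
  have hbefore : ∀ d : ℕ × ℕ, d < (r, c) → ∃ q < p, d = hookCell i q := by
    intro d hd
    have hdμ : d ∈ μ.cells := μ.isLowerSet hd.le (by simpa using hmem)
    obtain ⟨q, hq⟩ := π.1.surjective ⟨d, hdμ⟩
    have hdq : (π.1 q).1 = d := congrArg Subtype.val hq
    have hle : q ≤ ⟨p, hp⟩ := π.2 _ _ (by rw [hdq, hrc]; exact hd.le)
    have hne : (q : ℕ) ≠ p := by
      intro he
      have : q = ⟨p, hp⟩ := Fin.ext he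
      rw [this, hrc] at hdq
      exact hd.ne hdq.symm
    have hlt : (q : ℕ) < p := lt_of_le_of_ne hle hne
    exact ⟨q, hlt, by rw [← hdq]; exact ih q hlt q.2⟩
  have hother : ∀ q < p, hookCell i q ≠ (r, c) := by
    intro q hq he
    rw [← ih q hq (hq.trans hp), ← hrc] at he
    have := congrArg Fin.val (π.1.injective (Subtype.ext he))
    simp only at this
    omega
  have hup : ∀ r', r' + 1 = r → ∃ q < p, (r', c) = hookCell i q := fun r' hr' =>
    hbefore _ (Prod.mk_lt_mk.2 (Or.inl ⟨by omega, le_rfl⟩))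
  have hleft : ∀ c', c' + 1 = c → ∃ q < p, (r, c') = hookCell i q := fun c' hc' =>
    hbefore _ (Prod.mk_lt_mk.2 (Or.inr ⟨le_rfl, by omega⟩))
  have hdesc : ∀ p', p' + 1 = p → (c ≤ (hookCell i p').2 ↔ i ≤ p) := by
    intro p' hp'
    have h1 := succ_mem_columnDescents (π := π.1) (a := ⟨p', by omega⟩) (b := ⟨p, hp⟩) hp'
    rw [h, hrc, ih p' (by omega) (by omega)] at h1
    rw [← h1]
    exact ⟨fun h => h.1, fun h => ⟨h, show p ≤ n - 1 by omega⟩⟩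
  rw [hrc]
  rcases lt_or_ge p i with hpi | hpi
  · rw [hookCell_of_lt hpi]
    have hknown : ∀ q < p, hookCell i q = (0, q) := fun q hq => hookCell_of_lt (hq.trans hpi)
    have hcp : p ≤ c := by
      rcases p with _ | p'
      · exact Nat.zero_le c
      · have := hdesc p' rfl
        rw [hknown p' (by omega)] at this
        simp only at this
        omega
    have hr : r = 0 := by
      rcases r with _ | r'
      · rfl
      · obtain ⟨q, hq, he⟩ := hup r' rfl
        rw [hknown q hq] at he
        have := (Prod.mk.inj he).2
        omega
    have hc : c ≤ p := by
      rcases c with _ | c'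
      · exact Nat.zero_le p
      · obtain ⟨q, hq, he⟩ := hleft c' rfl
        rw [hknown q hq] at he
        have := (Prod.mk.inj he).2
        omega
    rw [hr, le_antisymm hc hcp]
  · rw [hookCell_of_le hpi]
    obtain ⟨p', rfl⟩ : ∃ p', p = p' + 1 := ⟨p - 1, by omega⟩
    have hd := (hdesc p' rfl).2 hpi
    have hci : c < i := by
      rcases lt_or_ge p' i with h' | h'
      · rw [hookCell_of_lt h'] at hd
        exact hd.trans_lt h'
      · rw [hookCell_of_le h'] at hd
        exact hd.trans_lt hi
    have hr : r ≠ 0 := fun hr => hother c (by omega) (by rw [hookCell_of_lt hci, hr])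
    have hc : c = 0 := by
      rcases c with _ | c'
      · rfl
      · obtain ⟨q, hq, he⟩ := hleft c' rfl
        rcases lt_or_ge p' i with h' | h'
        · rw [hookCell_of_lt (by omega)] at he
          exact absurd (Prod.mk.inj he).1 hr
        · rw [hookCell_of_le h'] at hd
          simp only at hd
          omega
    subst hc
    obtain ⟨r', rfl⟩ := Nat.exists_eq_succ_of_ne_zero hr
    obtain ⟨q, hq, he⟩ := hup r' rfl
    -- the cell above is the last one of the first column so far
    rcases lt_or_ge q i with hqi | hqi
    · rw [hookCell_of_lt hqi] at he
      obtain ⟨rfl, rfl⟩ := Prod.mk.inj he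
      rcases hpi.eq_or_lt with h' | h'
      · rw [h', Nat.add_sub_cancel_left]
      · refine absurd ?_ (hother i h')
        rw [hookCell_of_le le_rfl, Nat.add_sub_cancel_left]
    · rw [hookCell_of_le hqi] at he
      have hr' := (Prod.mk.inj he).1
      rcases (Nat.le_of_lt_succ hq).eq_or_lt with h' | h'
      · exact Prod.ext (by simp only; omega) rfl
      · refine absurd ?_ (hother (q + 1) (by omega))
        rw [hookCell_of_le (by omega)]
        exact Prod.ext (by simp only; omega) rfl

theorem hookCell_mem_hook {i : ℕ} (hi : 1 ≤ i) {p : ℕ} (hp : p < n) :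
    hookCell i p ∈ hook i (n - i) hi := by
  rcases lt_or_ge p i with h | h
  · rw [hookCell_of_lt h, mem_hook]
    omega
  · rw [hookCell_of_le h, mem_hook]
    omega

theorem hookCell_injective (i : ℕ) : Function.Injective (hookCell i) := by
  intro p q h
  rcases lt_or_ge p i with hp | hp <;> rcases lt_or_ge q i with hq | hq <;>
    simp only [hookCell_of_lt, hookCell_of_le, hp, hq, Prod.mk.injEq] at h <;> omega

theorem exists_hookCell_eq {i : ℕ} (hi : 1 ≤ i) (hin : i ≤ n) {c : ℕ × ℕ}
    (hc : c ∈ hook i (n - i) hi) : ∃ p < n, hookCell i p = c := by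
  obtain ⟨r, c⟩ := c
  rw [mem_hook] at hc
  rcases hc with ⟨rfl, hc⟩ | ⟨h1, h2, rfl⟩
  · exact ⟨c, by omega, hookCell_of_lt hc⟩
  · refine ⟨r + i - 1, by omega, ?_⟩
    rw [hookCell_of_le (by omega)]
    exact Prod.ext (by simp only; omega) rfl

/-- The cells of a hook in the order of `hookCell`. -/
noncomputable def hookEquiv {i : ℕ} (hi : 1 ≤ i) (hin : i ≤ n) :
    Fin n ≃ (hook i (n - i) hi).cells :=
  Equiv.ofBijective (fun p => ⟨hookCell i p, by simpa using hookCell_mem_hook hi p.2⟩)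
    ⟨fun p q h => Fin.ext (hookCell_injective i (congrArg Subtype.val h)), fun c => by
      obtain ⟨p, hp, h⟩ := exists_hookCell_eq hi hin ((YoungDiagram.mem_cells _).1 c.2)
      exact ⟨⟨p, hp⟩, Subtype.ext h⟩⟩

theorem hookEquiv_apply {i : ℕ} (hi : 1 ≤ i) (hin : i ≤ n) (p : Fin n) :
    (hookEquiv hi hin p).1 = hookCell i p := rfl

theorem card_hook {i : ℕ} (hi : 1 ≤ i) (hin : i ≤ n) : (hook i (n - i) hi).card = n := by
  simpa using (Fintype.card_congr (hookEquiv hi hin)).symm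

theorem hookEquiv_le {i : ℕ} (hi : 1 ≤ i) (hin : i ≤ n) (a b : Fin n)
    (h : (hookEquiv hi hin a).1 ≤ (hookEquiv hi hin b).1) : a ≤ b := by
  rw [hookEquiv_apply, hookEquiv_apply] at h
  rw [Fin.le_def]
  rcases lt_or_ge (a : ℕ) i with ha | ha <;> rcases lt_or_ge (b : ℕ) i with hb | hb <;>
    simp only [hookCell_of_lt, hookCell_of_le, ha, hb, Prod.mk_le_mk] at h <;> omega

theorem columnDescents_hookEquiv {i : ℕ} (hi : 1 ≤ i) (hin : i ≤ n) :
    columnDescents (hookEquiv hi hin) = {j : ℕ | i ≤ j ∧ j ≤ n - 1} := by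
  ext j
  constructor
  · rintro ⟨a, b, ha, rfl, h⟩
    have := b.2
    rw [hookEquiv_apply, hookEquiv_apply] at h
    refine ⟨?_, by omega⟩
    by_contra hb
    rw [hookCell_of_lt (by omega), hookCell_of_lt (by omega)] at h
    simp only at h
    omega
  · rintro ⟨h1, h2⟩
    refine ⟨⟨j - 1, by omega⟩, ⟨j, by omega⟩, Nat.sub_add_cancel (by omega), rfl, ?_⟩
    rw [hookEquiv_apply, hookEquiv_apply, hookCell_of_le h1]
    exact Nat.zero_le _

open Classical in
theorem card_standardTableau_columnDescents {i : ℕ} (hi : 1 ≤ i) (hin : i ≤ n) :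
    Nat.card {π : StandardTableau n μ // columnDescents π.1 = {j : ℕ | i ≤ j ∧ j ≤ n - 1}} =
      if μ = hook i (n - i) hi then 1 else 0 := by
  split_ifs with hμ
  · subst hμ
    have : Unique {π : StandardTableau n (hook i (n - i) hi) //
        columnDescents π.1 = {j : ℕ | i ≤ j ∧ j ≤ n - 1}} :=
      { default := ⟨⟨hookEquiv hi hin, hookEquiv_le hi hin⟩, columnDescents_hookEquiv hi hin⟩
        uniq := fun π => Subtype.ext (Subtype.ext (Equiv.ext fun p =>
          Subtype.ext (eq_hookCell hi π.1 π.2 p))) }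
    exact Nat.card_unique
  · have : IsEmpty {π : StandardTableau n μ //
        columnDescents π.1 = {j : ℕ | i ≤ j ∧ j ≤ n - 1}} := by
      refine ⟨fun π => hμ (YoungDiagram.ext ?_)⟩
      ext c
      constructor
      · intro hc
        obtain ⟨p, hp⟩ := π.1.1.surjective ⟨c, hc⟩
        have := eq_hookCell hi π.1 π.2 p
        rw [hp] at this
        simp only at this
        rw [this]
        simpa using hookCell_mem_hook hi p.2
      · intro hc
        obtain ⟨p, hp, rfl⟩ := exists_hookCell_eq hi hin (by simpa using hc)
        rw [← eq_hookCell hi π.1 π.2 ⟨p, hp⟩]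
        exact (π.1.1 _).2
    exact Nat.card_of_isEmpty

/-! ### The hook coefficients -/

theorem apply_sum_fundamental {X : Type} [Fintype X] {d : X → Set ℕ} {I : Set ℕ}
    (φ : MvPowerSeries ℕ ℚ →ₗ[ℚ] ℚ) [∀ x, Decidable (d x = I)]
    (hφ : ∀ x, φ (fundamental n (d x)) = if d x = I then 1 else 0) :
    φ (∑ x, fundamental n (d x)) = (Nat.card {x // d x = I} : ℚ) := by
  rw [map_sum, Finset.sum_congr rfl fun x _ => hφ x, Finset.sum_boole, Nat.card_eq_fintype_card,
    Fintype.card_subtype]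

/-- The coefficient of `F_I` with `I = {i, …, n - 1}` vanishes in all Schur functions except the one
of the hook, where it is `1`. -/
theorem coeff_hook_eq {D : Digraph (Fin n)} {c : YoungDiagram →₀ ℚ}
    (hc : IsSchurExpansion (redeiBerge D) c) {i : ℕ} (hi : 1 ≤ i) (hin : i ≤ n) :
    c (hook i (n - i) hi) =
      (Nat.card {σ : Equiv.Perm (Fin n) // descents D σ = {j : ℕ | i ≤ j ∧ j ≤ n - 1}} : ℚ) := by
  classical
  obtain ⟨φ, h1, h2⟩ := exists_fundamental_functional n (Finset.Icc i (n - 1))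
  have hI : ((Finset.Icc i (n - 1) : Finset ℕ) : Set ℕ) = {j : ℕ | i ≤ j ∧ j ≤ n - 1} := by
    ext j
    simp
  rw [hI] at h1
  have hschur : ∀ μ, φ (schur μ) = if μ = hook i (n - i) hi then 1 else 0 := by
    intro μ
    by_cases hμ : μ.card = n
    · rw [schur_eq_sum_fundamental hμ,
        apply_sum_fundamental φ fun π : StandardTableau n μ => h1 _ (columnDescents_subset π.1),
        card_standardTableau_columnDescents hi hin]
      split_ifs <;> simp
    · rw [if_neg fun h : μ = _ => hμ (h ▸ card_hook hi hin), h2]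
      exact fun m hm => coeff_schur_eq_zero_of_degree fun h => hμ (h.symm.trans hm)
  have hU := apply_sum_fundamental φ fun π => h1 _ (descents_subset D π)
  change φ (redeiBerge D) = _ at hU
  rw [← hU, show redeiBerge D = _ from hc, Finsupp.linearCombination_apply, Finsupp.sum, map_sum]
  simp only [map_smul, hschur, smul_eq_mul, mul_ite, mul_one, mul_zero, Finset.sum_ite_eq']
  split_ifs with h
  · rfl
  · exact Finsupp.notMem_support_iff.1 h

/-! ### Hamiltonian paths -/

theorem isHamiltonianPath_ofFn {D : Digraph (Fin n)} (σ : Equiv.Perm (Fin n)) :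
    IsHamiltonianPath D (List.ofFn σ) ↔
      ∀ a b : Fin n, (a : ℕ) + 1 = b → D.Adj (σ a) (σ b) := by
  have h1 : (List.ofFn σ).Nodup := List.nodup_ofFn.2 σ.injective
  have h2 : ∀ v, v ∈ List.ofFn σ := fun v => (List.mem_ofFn' _ _).2 (σ.surjective v)
  rw [IsHamiltonianPath, and_iff_left ⟨h1, h2⟩, List.isChain_iff_getElem]
  simp only [List.length_ofFn, List.getElem_ofFn]
  constructor
  · intro h a b hab
    have := h a (by omega)
    simp only [hab] at this
    exact this
  · intro h k hk
    exact h _ _ rfl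

theorem exists_perm_of_isHamiltonianPath {D : Digraph (Fin n)} {p : List (Fin n)}
    (hp : IsHamiltonianPath D p) : ∃ σ : Equiv.Perm (Fin n), List.ofFn σ = p := by
  let e := hp.2.1.getEquivOfForallMemList p hp.2.2
  have hlen : p.length = n := by simpa using Fintype.card_congr e
  refine ⟨(finCongr hlen.symm).trans e, List.ext_getElem (by simp [hlen]) fun k h1 h2 => ?_⟩
  simp [e]

theorem ham_eq_card (D : Digraph (Fin n)) :
    ham D = Nat.card {σ : Equiv.Perm (Fin n) //
      ∀ a b : Fin n, (a : ℕ) + 1 = b → D.Adj (σ a) (σ b)} := by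
  symm
  refine Nat.card_congr (Equiv.ofBijective
    (fun σ => ⟨List.ofFn σ.1, (isHamiltonianPath_ofFn σ.1).2 σ.2⟩) ⟨fun σ τ h => ?_, ?_⟩)
  · exact Subtype.ext (DFunLike.coe_injective (List.ofFn_injective (congrArg Subtype.val h)))
  · rintro ⟨p, hp⟩
    obtain ⟨σ, rfl⟩ := exists_perm_of_isHamiltonianPath hp
    exact ⟨⟨σ, (isHamiltonianPath_ofFn σ).1 hp⟩, rfl⟩

theorem descents_eq_all_iff (D : Digraph (Fin n)) (σ : Equiv.Perm (Fin n)) :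
    descents D σ = {j : ℕ | 1 ≤ j ∧ j ≤ n - 1} ↔
      ∀ a b : Fin n, (a : ℕ) + 1 = b → D.Adj (σ a) (σ b) := by
  constructor
  · intro h a b hab
    rw [← succ_mem_descents hab, h]
    have := b.2
    exact ⟨by omega, by omega⟩
  · intro h
    refine Set.Subset.antisymm (fun j hj => ?_) fun j hj => ?_
    · have := descents_subset D σ hj
      exact ⟨this.1, Nat.le_sub_one_of_lt this.2⟩
    · obtain ⟨h1, h2⟩ : 1 ≤ j ∧ j ≤ n - 1 := hj
      exact ⟨⟨j - 1, by omega⟩, ⟨j, by omega⟩, Nat.sub_add_cancel h1, rfl,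
        h _ _ (Nat.sub_add_cancel h1)⟩

theorem descents_eq_none_iff (hn : 1 ≤ n) (D : Digraph (Fin n)) (σ : Equiv.Perm (Fin n)) :
    descents D σ = {j : ℕ | n ≤ j ∧ j ≤ n - 1} ↔
      ∀ a b : Fin n, (a : ℕ) + 1 = b → Dᶜ.Adj (σ a) (σ b) := by
  have hempty : {j : ℕ | n ≤ j ∧ j ≤ n - 1} = ∅ :=
    Set.eq_empty_of_forall_notMem fun j hj => by
      obtain ⟨h1, h2⟩ : n ≤ j ∧ j ≤ n - 1 := hj
      omega
  rw [hempty, Set.eq_empty_iff_forall_notMem]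
  constructor
  · intro h a b hab
    rw [Digraph.compl_adj, ← succ_mem_descents hab]
    exact h b
  · rintro h j ⟨a, b, hab, rfl, hadj⟩
    exact h a b hab hadj

theorem oneColumn_eq_hook (hn : 1 ≤ n) : oneColumn n = hook 1 (n - 1) le_rfl := by
  simp only [oneColumn, hook]
  congr 1
  rw [← List.replicate_succ, Nat.sub_add_cancel hn]

theorem oneRow_eq_hook (hn : 1 ≤ n) : oneRow n = hook n (n - n) hn := by
  simp only [oneRow, hook]
  congr 1
  rw [Nat.sub_self, List.replicate_zero]

theorem ham_of_eq_zero (D : Digraph (Fin 0)) : ham D = 1 := by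
  rw [ham_eq_card, Nat.card_eq_one_iff_unique]
  exact ⟨inferInstance, ⟨1, fun a => a.elim0⟩⟩

theorem eq_bot_of_card_eq_zero (hμ : μ.card = 0) : μ = ⊥ :=
  YoungDiagram.ext (Finset.card_eq_zero.1 hμ)

theorem coeff_bot_eq_one {D : Digraph (Fin 0)} {c : YoungDiagram →₀ ℚ}
    (hc : IsSchurExpansion (redeiBerge D) c) : c ⊥ = 1 := by
  have hbot : shapeWeight ⊥ = 0 := by simp [shapeWeight, tableauWeight]
  have hU : MvPowerSeries.coeff 0 (redeiBerge D) = 1 := by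
    have h := coeff_stepWord_fundamental ∅ (descents_subset D 1)
    rw [Finset.univ_eq_empty, Finset.sum_empty, if_pos] at h
    · simpa [redeiBerge] using h
    · rintro j ⟨a, -⟩
      exact a.elim0
  rw [show redeiBerge D = _ from hc, coeff_linearCombination_schur] at hU
  rw [← hU, Finset.sum_eq_single ⊥]
  · rw [← hbot, coeff_schur_shapeWeight_self, mul_one]
  · intro μ _ hμ
    rw [coeff_schur_eq_zero_of_degree, mul_zero]
    rw [map_zero]
    exact fun h => hμ (eq_bot_of_card_eq_zero h.symm)
  · intro h
    rw [Finsupp.notMem_support_iff.1 h, zero_mul]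

end

end RedeiBerge

theorem proposition26 (n : ℕ) (D : Digraph (Fin n)) :
    (∃! c : YoungDiagram →₀ ℚ, RedeiBerge.IsSchurExpansion (RedeiBerge.redeiBerge D) c) ∧
    ∀ c : YoungDiagram →₀ ℚ, RedeiBerge.IsSchurExpansion (RedeiBerge.redeiBerge D) c →
      (∀ (i : ℕ) (hi : 1 ≤ i), i ≤ n →
        c (RedeiBerge.hook i (n - i) hi) =
          (Nat.card {σ : Equiv.Perm (Fin n) //
            RedeiBerge.descents D σ = {j : ℕ | i ≤ j ∧ j ≤ n - 1}} : ℚ)) ∧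
      c (RedeiBerge.oneColumn n) = (RedeiBerge.ham D : ℚ) ∧
      c (RedeiBerge.oneRow n) = (RedeiBerge.ham Dᶜ : ℚ) := by
  open RedeiBerge in
  refine ⟨?_, fun c hc => ⟨fun i hi hin => coeff_hook_eq hc hi hin, ?_⟩⟩
  · obtain ⟨c, hc⟩ := exists_isSchurExpansion (isSymmetricSeries_redeiBerge D)
      fun m hm => coeff_redeiBerge_eq_zero_of_degree D hm
    exact ⟨c, hc, fun c' hc' => linearIndependent_schur (hc'.symm.trans hc)⟩
  · rcases Nat.eq_zero_or_pos n with rfl | hn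
    · have h1 : oneColumn 0 = ⊥ := eq_bot_of_card_eq_zero rfl
      have h2 : oneRow 0 = ⊥ := eq_bot_of_card_eq_zero rfl
      rw [h1, h2, coeff_bot_eq_one hc, ham_of_eq_zero, ham_of_eq_zero, Nat.cast_one]
      exact ⟨rfl, rfl⟩
    · rw [oneColumn_eq_hook hn, oneRow_eq_hook hn, coeff_hook_eq hc le_rfl hn,
        coeff_hook_eq hc hn le_rfl, ham_eq_card, ham_eq_card]
      simp only [descents_eq_all_iff, descents_eq_none_iff hn, and_self]
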